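/- Let $\mu$ be a positive Radon measure on $\mathbb{R}$ concentrated on $\mathbb{N}_0$, with $\mu_0=\mu(\{0\})>0$, $\mu_1=\mu(\{1\})>0$, and with $\Theta_\mu=\mathrm{int}\{\theta:\int e^{\theta x}\mu(dx)<\infty\}\neq\emptyset$. For any such (generating) measure $\nu$ on $\mathbb R$ put $L_\nu(\theta)=\int e^{\theta x}\nu(dx)$, $k_\nu=\log L_\nu$, let $\mathcal F(\nu)=\{e^{\theta x-k_\nu(\theta)}\nu(dx):\theta\in\Theta_\nu\}$ be the natural exponential family (NEF) generated by $\nu$, $M_\nu=k_\nu'(\Theta_\nu)$ its mean domain, and $V_\nu(m)=k_\nu''\big((k_\nu')^{-1}(m)\big)$, $m\in M_\nu$, its variance function. Write $M=M_\mu$, $V=V_\mu$, and let $\psi,\phi$ be primitives on $M$ of $1/V(m)$ and $m/V(m)$, respectively, with $$\lim_{m\downarrow0}\phi'(m)=1,\qquad \lim_{m\downarrow0}m\,e^{-\psi(m)}=c\quad\text{for some constant } c>0 .$$ Let $\Lambda$ be the set of all $p>0$ for which there is a measure $\mu_p$ on $\mathbb R$ with $\Theta_{\mu_p}=\Theta_\mu$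 and $L_{\mu_p}=L_\mu^{\,p}$ on $\Theta_\mu$, and let $\mathcal F_p=\mathcal F(\mu_p)$, $p\in\Lambda$, be the exponential dispersion model originating from $\mathcal F(\mu)$. Then for every $p\in\Lambda$, with $$\psi_p(m)=\psi(m/p),\qquad \phi_p(m)=p\,\phi(m/p),\qquad G_p(m)=m\,e^{-\psi_p(m)},$$ the following hold. The mean domain of $\mathcal F_p$ is $M_p=pM$; on it $\psi_p$ and $\phi_p$ are primitives of $1/V_{\mu_p}(m)$ and $m/V_{\mu_p}(m)$; $\lim_{m\downarrow0}\phi_p'(m)=1$ and $\lim_{m\downarrow 0}G_p(m)=pc$ (which is $p$ under the normalization $c=1$). Moreover, the functions $e^{\phi_p}$ and $e^{\phi_p}\phi_p'\,G_p^{\,n}$ ($n\ge1$) continue analytically from a right neighbourhood of $0$ to a neighbourhood of $m=0$, the numbers $$(\mu_p^*)_0=e^{\phi_p(m)}\Big|_{m=0},\qquad (\mu_p^*)_n=\frac1{n!}\Big(\frac{d}{dm}\Big)^{n-1}\Big(e^{\phi_p(m)}\,\phi_p'(m)\,G_p(m)^n\Big)\Big|_{m=0},\quad n=1,2,\dots,$$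 are the masses of a positive Radon measure $\mu_p^*$ on $\mathbb N_0$ with $\Theta_{\mu_p^*}\ne\emptyset$, and $\mu_p^*$ generates $\mathcal F_p$: $$\mathcal F_p=\mathcal F(\mu_p^*)=\big\{e^{x\psi_p(m)-\phi_p(m)}\,\mu_p^*(dx):m\in pM\big\}.$$ -/

import Mathlib

open Set Filter Topology MeasureTheory ProbabilityTheory

noncomputable section

namespace NEF

/-- The open interval `Θ_μ`: the interior of the set `D_μ` of all `θ` with `∫ exp (θ x) μ(dx) < ∞`. -/
def canonicalDomain (μ : Measure ℝ) : Set ℝ := interior (integrableExpSet id μ)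

/-- The class of positive Radon measures on `ℝ` that generate a natural exponential family. -/
structure IsGenerating (μ : Measure ℝ) : Prop where
  locallyFinite : IsLocallyFiniteMeasure μ
  nonempty_domain : (canonicalDomain μ).Nonempty

/-- The Laplace transform `L_μ(θ) = ∫ exp (θ x) μ(dx)`. -/
def laplace (μ : Measure ℝ) (θ : ℝ) : ℝ := mgf id μ θ

/-- The cumulant transform `k_μ = log L_μ`. -/
def cumulant (μ : Measure ℝ) (θ : ℝ) : ℝ := cgf id μ θ

/-- The natural exponential family `F(μ) = {exp (θ x - k_μ(θ)) μ(dx) : θ ∈ Θ_μ}`. -/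
def nef (μ : Measure ℝ) : Set (Measure ℝ) :=
  (fun θ : ℝ => μ.withDensity fun x => ENNReal.ofReal (Real.exp (θ * x - cumulant μ θ))) ''
    canonicalDomain μ

/-- The mean domain `M_μ = k_μ'(Θ_μ)`. -/
def meanDomain (μ : Measure ℝ) : Set ℝ := deriv (cumulant μ) '' canonicalDomain μ

/-- The variance function `V(m) = k_μ''((k_μ')⁻¹(m))`, for `m ∈ M_μ`. -/
def varianceFun (μ : Measure ℝ) (m : ℝ) : ℝ :=
  iteratedDeriv 2 (cumulant μ) (Function.invFunOn (deriv (cumulant μ)) (canonicalDomain μ) m)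

/-- `μp` is a measure with `L_μp = L_μ ^ p` on `Θ_μp = Θ_μ`. -/
def IsPower (μ : Measure ℝ) (p : ℝ) (μp : Measure ℝ) : Prop :=
  canonicalDomain μp = canonicalDomain μ ∧
    ∀ θ ∈ canonicalDomain μ, laplace μp θ = laplace μ θ ^ p

/-- The Jorgensen set `Λ` of `μ`. -/
def jorgensenSet (μ : Measure ℝ) : Set ℝ := {p | 0 < p ∧ ∃ μp, IsPower μ p μp}

/-- `ψ` is a primitive of `1 / V` and `φ` one of `m / V` on the mean domain of `μ`. -/
structure IsPrimitivePair (μ : Measure ℝ) (ψ φ : ℝ → ℝ) : Prop where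
  psi : ∀ m ∈ meanDomain μ, HasDerivAt ψ (1 / varianceFun μ m) m
  phi : ∀ m ∈ meanDomain μ, HasDerivAt φ (m / varianceFun μ m) m

/-- The members of the mean value parameterization: `exp (x ψ(m) - φ(m)) ν(dx)`, `m ∈ M`. -/
def meanFamily (ψ φ : ℝ → ℝ) (ν : Measure ℝ) (M : Set ℝ) : Set (Measure ℝ) :=
  (fun m : ℝ => ν.withDensity fun x => ENNReal.ofReal (Real.exp (x * ψ m - φ m))) '' M

/-- The function `G(m) = m exp (-ψ(m))`. -/
def letacMoraG (ψ : ℝ → ℝ) (m : ℝ) : ℝ := m * Real.exp (-ψ m)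

/-- `(d/dm)^k f |_{m = 0} = a`, for a function `f` given on some interval `(0, ε)`: it continues
analytically to a neighbourhood of `0`, and `a` is the `k`-th derivative at `0` of the
continuation (whose germ at `0` is unique). -/
def HasDerivAtZero (f : ℝ → ℝ) (k : ℕ) (a : ℝ) : Prop :=
  ∃ g : ℝ → ℝ, AnalyticAt ℝ g 0 ∧ f =ᶠ[𝓝[>] 0] g ∧ iteratedDeriv k g 0 = a

/-- `μ` is concentrated on the nonnegative integers. -/
def IsCounting (μ : Measure ℝ) : Prop := μ (range ((↑) : ℕ → ℝ))ᶜ = 0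

/-- `ν` is the measure on the nonnegative integers whose masses are the Letac-Mora numbers
`ν_0 = exp φ |_{m=0}` and `ν_n = (1/n!) (d/dm)^(n-1) (exp φ * φ' * G^n) |_{m=0}`, `n ≥ 1`. -/
structure IsLetacMora (ψ φ : ℝ → ℝ) (ν : Measure ℝ) : Prop where
  counting : IsCounting ν
  mass_ne_top : ∀ n : ℕ, ν {(n : ℝ)} ≠ ⊤
  mass_zero : HasDerivAtZero (fun m => Real.exp (φ m)) 0 (ν.real {0})
  mass_pos : ∀ n : ℕ, 1 ≤ n → ∃ d : ℝ,
    HasDerivAtZero (fun m => Real.exp (φ m) * deriv φ m * letacMoraG ψ m ^ n) (n - 1) d ∧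
      ν.real {(n : ℝ)} = 1 / (n.factorial : ℝ) * d

end NEF

end

/-! In the coordinate `z = exp θ`, a measure `ν` on the nonnegative integers has Laplace transform
`f(z) = ∑ ν_n z ^ n`, and its mean is `m = z u(z)` with `u = f' / f`. If `ν` charges 0 and 1, then
`u(0) > 0`, so `z ↦ m` has an analytic local inverse `ζ`. When `ψ(m) = θ` and `φ(m) = k_ν(θ)`, this
reads `exp φ = f ∘ ζ` and `G = m / z = u ∘ ζ`. The claimed masses are then Lagrange inversion for
the coefficients of `f` (`IsCounting.isLetacMora`).

An arbitrary primitive pair differs from this one by two additive constants, which an exponential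
tilt of the measure absorbs without changing the family (`exists_isLetacMora`).

It remains to see that `μp` is of this type. As `f(0) = μ_0 > 0`, the power `f ^ p` is analytic at
0, and uniqueness of Laplace transforms identifies `μp` with the sequence of its Taylor coefficients
(`IsPower.isCounting`). The first two, `f(0) ^ p` and `p f(0) ^ (p - 1) f'(0)`, are positive
(`IsPower.atoms_pos`). -/

namespace NEF

/-! ### Lagrange inversion and local inverses of analytic germs -/

section Analytic

lemma iteratedDeriv_id_mul {g : ℝ → ℝ} (hg : AnalyticAt ℝ g 0) (n : ℕ) :
    iteratedDeriv (n + 1) (fun z => z * g z) 0 = (n + 1) * iteratedDeriv n g 0 := by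
  have h := iteratedDeriv_mul (n := n + 1) (x := (0 : ℝ)) (f := fun z : ℝ => z) (g := g)
    contDiffAt_id hg.contDiffAt
  have e : (fun z => z * g z) = (fun z : ℝ => z) * g := rfl
  rw [e, h, Finset.sum_eq_single 1]
  · simp [iteratedDeriv_one]
  · intro i _ hi
    have : iteratedDeriv i (fun z : ℝ => z) 0 = 0 := by
      rw [show (fun z : ℝ => z) = fun z => z ^ 1 by simp, iteratedDeriv_fun_pow_zero]
      simp [hi]
    simp [this]
  · simp

/-- The formal residue computation behind Lagrange inversion. -/
lemma iteratedDeriv_deriv_id_mul_mul_inv_pow {u : ℝ → ℝ} (hu : AnalyticAt ℝ u 0) (hu0 : u 0 ≠ 0)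
    (n : ℕ) :
    iteratedDeriv (n + 1) (fun z => deriv (fun z => z * u z) z * (u z)⁻¹ ^ (n + 2)) 0 = 0 := by
  have hinv : AnalyticAt ℝ (fun z => (u z)⁻¹) 0 := hu.inv hu0
  -- With this `w` the function equals `w - z w' / (n + 1)`, and taking `n + 1` derivatives of `z
  -- w'` at 0 yields the factor `n + 1` that cancels.
  set w : ℝ → ℝ := fun z => (u z)⁻¹ ^ (n + 1) with hw
  have hwa : AnalyticAt ℝ w 0 := hinv.pow _
  have hn : ((n : ℝ) + 1) ≠ 0 := by positivity
  have key : (fun z => deriv (fun z => z * u z) z * (u z)⁻¹ ^ (n + 2)) =ᶠ[𝓝 0]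
      fun z => w z + (-1 / ((n : ℝ) + 1)) * (z * deriv w z) := by
    filter_upwards [hu.eventually_analyticAt, hu.continuousAt.eventually_ne hu0] with z hz hz0
    have hd := hz.differentiableAt.hasDerivAt
    have e1 : deriv (fun z => z * u z) z = u z + z * deriv u z := by
      simpa using ((hasDerivAt_id' z).fun_mul hd).deriv
    have e2 : deriv w z = (n + 1 : ℕ) * (u z)⁻¹ ^ n * (-deriv u z / u z ^ 2) := by
      simpa [hw] using ((hd.fun_inv hz0).fun_pow (n + 1)).deriv
    rw [e1, e2]
    simp only [hw, inv_pow]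
    push_cast
    field_simp
    ring
  rw [key.iteratedDeriv_eq, iteratedDeriv_fun_add hwa.contDiffAt, iteratedDeriv_const_mul,
    iteratedDeriv_id_mul hwa.deriv, iteratedDeriv_succ']
  · field_simp
    ring
  · exact (analyticAt_id.fun_mul hwa.deriv).contDiffAt
  · exact (analyticAt_const.mul (analyticAt_id.fun_mul hwa.deriv)).contDiffAt

/-- Lagrange inversion for real analytic germs: invariance of the residue of `F(m) / m ^ (n + 1)`
under the change of variables `m = z * u z`. -/
lemma iteratedDeriv_comp_mul_deriv_mul_inv_pow {u : ℝ → ℝ} (hu : AnalyticAt ℝ u 0) (hu0 : u 0 ≠ 0)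
    (n : ℕ) {F : ℝ → ℝ} (hF : AnalyticAt ℝ F 0) :
    iteratedDeriv n
      (fun z => F (z * u z) * (deriv (fun z => z * u z) z * (u z)⁻¹ ^ (n + 1))) 0 =
      iteratedDeriv n F 0 := by
  have hinv : AnalyticAt ℝ (fun z => (u z)⁻¹) 0 := hu.inv hu0
  have hm : AnalyticAt ℝ (fun z => z * u z) 0 := analyticAt_id.fun_mul hu
  induction n generalizing F with
  | zero =>
    have e1 : deriv (fun z => z * u z) 0 = u 0 := by
      simpa using ((hasDerivAt_id' (0 : ℝ)).fun_mul hu.differentiableAt.hasDerivAt).deriv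
    simp [e1, hu0]
  | succ n ih =>
    -- Write `F(m) = F(0) + m F1(m)`. The constant part has no residue; in the other, `m = z u`
    -- removes one factor `u⁻¹` and lowers the order by one.
    set F1 := dslope F 0 with hF1
    have hF1a : AnalyticAt ℝ F1 0 := by
      obtain ⟨p, hp⟩ := hF
      exact hp.has_fpower_series_dslope_fslope.analyticAt
    have hFe : ∀ z, F z = F 0 + z * F1 z := by
      intro z
      have := sub_smul_dslope F 0 z
      simp only [sub_zero, smul_eq_mul] at this
      rw [hF1, this]; ring
    have hzF : AnalyticAt ℝ (fun z => z * F1 z) 0 := analyticAt_id.fun_mul hF1a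
    have hcomp : AnalyticAt ℝ (fun z => F1 (z * u z)) 0 :=
      AnalyticAt.fun_comp (by simpa using hF1a) hm
    have hR : ∀ k, AnalyticAt ℝ (fun z => deriv (fun z => z * u z) z * (u z)⁻¹ ^ k) 0 :=
      fun k => hm.deriv.mul (hinv.pow k)
    have key : (fun z => F (z * u z) * (deriv (fun z => z * u z) z * (u z)⁻¹ ^ (n + 1 + 1)))
        =ᶠ[𝓝 0] fun z => F 0 * (deriv (fun z => z * u z) z * (u z)⁻¹ ^ (n + 2)) +
          z * (F1 (z * u z) * (deriv (fun z => z * u z) z * (u z)⁻¹ ^ (n + 1))) := by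
      filter_upwards [hu.continuousAt.eventually_ne hu0] with z hz0
      rw [hFe (z * u z)]
      simp only [inv_pow]
      field_simp
      ring
    have hFf : F = fun z => F 0 + z * F1 z := funext hFe
    rw [key.iteratedDeriv_eq, iteratedDeriv_fun_add, iteratedDeriv_const_mul,
      iteratedDeriv_deriv_id_mul_mul_inv_pow hu hu0,
      iteratedDeriv_id_mul (hcomp.fun_mul (hR _)), ih hF1a]
    · conv_rhs => rw [hFf]
      rw [iteratedDeriv_fun_add contDiffAt_const hzF.contDiffAt,
        iteratedDeriv_id_mul hF1a]
      simp [iteratedDeriv_const]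
    · exact (hR _).contDiffAt
    · exact (analyticAt_const.mul (hR _)).contDiffAt
    · exact (analyticAt_id.fun_mul (hcomp.fun_mul (hR _))).contDiffAt

/-- The local inverse of a real analytic function with nonzero derivative is analytic. -/
lemma exists_analyticAt_inverse {m : ℝ → ℝ} (hm : AnalyticAt ℝ m 0) (hm0 : m 0 = 0)
    (hd : deriv m 0 ≠ 0) :
    ∃ ζ : ℝ → ℝ, AnalyticAt ℝ ζ 0 ∧ ζ 0 = 0 ∧
      (∀ᶠ x in 𝓝 0, m (ζ x) = x) ∧ ∀ᶠ z in 𝓝 0, ζ (m z) = z := by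
  have hs : HasStrictDerivAt m (deriv m 0) 0 := hm.hasStrictDerivAt
  have hs' := hs.hasStrictFDerivAt_equiv hd
  refine ⟨hs.localInverse m _ 0 hd, ?_, ?_, ?_, ?_⟩
  · have := (hs'.toOpenPartialHomeomorph m).analyticAt_symm' (a := 0)
      (i := ContinuousLinearEquiv.unitsEquivAut ℝ (Units.mk0 _ hd))
      hs'.mem_toOpenPartialHomeomorph_source hm hs'.hasFDerivAt.fderiv
    rw [hs'.toOpenPartialHomeomorph_coe, hm0] at this
    exact this
  · have := hs'.localInverse_apply_image
    rwa [hm0] at this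
  · have := hs'.eventually_right_inverse
    rwa [hm0] at this
  · exact hs'.eventually_left_inverse

end Analytic

/-! ### Convexity of the cumulant transform and the mean parameterization -/

section Cumulant

variable {μ : Measure ℝ}

lemma isOpen_canonicalDomain (μ : Measure ℝ) : IsOpen (canonicalDomain μ) := isOpen_interior

lemma convex_canonicalDomain (μ : Measure ℝ) : Convex ℝ (canonicalDomain μ) :=
  convex_integrableExpSet.interior

lemma integrable_of_mem_canonicalDomain {θ : ℝ} (h : θ ∈ canonicalDomain μ) :
    Integrable (fun x => Real.exp (θ * x)) μ :=
  interior_subset (s := integrableExpSet id μ) h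

lemma laplace_pos (hμ : μ ≠ 0) {θ : ℝ} (h : θ ∈ canonicalDomain μ) : 0 < laplace μ θ :=
  mgf_pos' hμ (integrable_of_mem_canonicalDomain h)

lemma analyticAt_cumulant {θ : ℝ} (h : θ ∈ canonicalDomain μ) : AnalyticAt ℝ (cumulant μ) θ :=
  analyticAt_cgf h

lemma hasDerivAt_cumulant {θ : ℝ} (h : θ ∈ canonicalDomain μ) :
    HasDerivAt (cumulant μ) (deriv (cumulant μ) θ) θ :=
  (analyticAt_cumulant h).differentiableAt.hasDerivAt

lemma hasDerivAt_deriv_cumulant {θ : ℝ} (h : θ ∈ canonicalDomain μ) :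
    HasDerivAt (deriv (cumulant μ)) (iteratedDeriv 2 (cumulant μ) θ) θ := by
  rw [iteratedDeriv_succ, iteratedDeriv_one]
  exact (analyticAt_cumulant h).deriv.differentiableAt.hasDerivAt

lemma ne_zero_of_atom {a : ℝ} (h : 0 < μ {a}) : μ ≠ 0 := by
  rintro rfl
  simp at h

/-- The cumulant transform of a measure with two atoms is strictly convex. -/
lemma iteratedDeriv_two_cumulant_pos {a b : ℝ} (hab : a ≠ b) (ha : 0 < μ {a}) (hb : 0 < μ {b})
    {θ : ℝ} (h : θ ∈ canonicalDomain μ) : 0 < iteratedDeriv 2 (cumulant μ) θ := by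
  have hμ := ne_zero_of_atom ha
  have hpos : 0 < mgf id μ θ := laplace_pos hμ h
  set κ := deriv (cgf id μ) θ with hκ
  have hform : iteratedDeriv 2 (cumulant μ) θ =
      (∫ x, (x - κ) ^ 2 * Real.exp (θ * x) ∂μ) / mgf id μ θ :=
    iteratedDeriv_two_cgf_eq_integral h
  have hint : Integrable (fun x => (x - κ) ^ 2 * Real.exp (θ * x)) μ := by
    have h2 := integrable_pow_mul_exp_of_mem_interior_integrableExpSet (X := id) h 2
    have h1 := integrable_pow_mul_exp_of_mem_interior_integrableExpSet (X := id) h 1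
    have h0 := integrable_pow_mul_exp_of_mem_interior_integrableExpSet (X := id) h 0
    refine ((h2.sub (h1.const_mul (2 * κ))).add (h0.const_mul (κ ^ 2))).congr
      (Eventually.of_forall fun x => ?_)
    simp only [id, Pi.add_apply, Pi.sub_apply]
    ring
  have hnn : 0 ≤ fun x => (x - κ) ^ 2 * Real.exp (θ * x) := fun x => by positivity
  rw [hform]
  refine div_pos (lt_of_le_of_ne (integral_nonneg hnn) fun h0 => hab ?_) hpos
  have hae := (integral_eq_zero_iff_of_nonneg hnn hint).1 h0.symm
  -- Zero variance puts all the mass at the mean `κ`, so there cannot be two distinct atoms.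
  have hatom : ∀ c, 0 < μ {c} → c = κ := by
    intro c hc
    by_contra hne
    refine hc.ne' (measure_mono_null ?_ (ae_iff.1 hae))
    rintro x rfl
    simp [sub_ne_zero.2 hne]
  rw [hatom a ha, hatom b hb]

lemma strictMonoOn_deriv_cumulant
    (hpos : ∀ θ ∈ canonicalDomain μ, 0 < iteratedDeriv 2 (cumulant μ) θ) :
    StrictMonoOn (deriv (cumulant μ)) (canonicalDomain μ) := by
  refine strictMonoOn_of_deriv_pos (convex_canonicalDomain μ)
    (fun θ h => (hasDerivAt_deriv_cumulant h).continuousAt.continuousWithinAt) fun θ h => ?_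
  rw [(isOpen_canonicalDomain μ).interior_eq] at h
  rw [(hasDerivAt_deriv_cumulant h).deriv]
  exact hpos θ h

lemma varianceFun_deriv_cumulant
    (hpos : ∀ θ ∈ canonicalDomain μ, 0 < iteratedDeriv 2 (cumulant μ) θ)
    {θ : ℝ} (h : θ ∈ canonicalDomain μ) :
    varianceFun μ (deriv (cumulant μ) θ) = iteratedDeriv 2 (cumulant μ) θ := by
  rw [varianceFun, (strictMonoOn_deriv_cumulant hpos).injOn.leftInvOn_invFunOn h]

lemma exists_eq_add_const_of_hasDerivAt {s : Set ℝ} (hs : IsOpen s) (hc : Convex ℝ s)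
    {f g f' : ℝ → ℝ} (hf : ∀ x ∈ s, HasDerivAt f (f' x) x) (hg : ∀ x ∈ s, HasDerivAt g (f' x) x) :
    ∃ C, ∀ x ∈ s, f x = g x + C := by
  rcases s.eq_empty_or_nonempty with rfl | ⟨x₀, hx₀⟩
  · exact ⟨0, by simp⟩
  refine ⟨f x₀ - g x₀, fun x hx => ?_⟩
  have h := hs.is_const_of_deriv_eq_zero (f := f - g) hc.isPreconnected
    (fun y hy => ((hf y hy).sub (hg y hy)).differentiableAt.differentiableWithinAt)
    (fun y hy => by simpa using ((hf y hy).sub (hg y hy)).deriv) hx hx₀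
  simp only [Pi.sub_apply] at h
  linarith

/-- Along the mean map `k'`, the primitives of `1 / V` and `m / V` are the canonical parameter and
the cumulant transform, up to constants. -/
lemma IsPrimitivePair.exists_const {ψ φ : ℝ → ℝ} (h : IsPrimitivePair μ ψ φ)
    (hpos : ∀ θ ∈ canonicalDomain μ, 0 < iteratedDeriv 2 (cumulant μ) θ) :
    ∃ C₁ C₂ : ℝ, ∀ θ ∈ canonicalDomain μ,
      ψ (deriv (cumulant μ) θ) = θ + C₁ ∧ φ (deriv (cumulant μ) θ) = cumulant μ θ + C₂ := by
  have h1 : ∀ θ ∈ canonicalDomain μ, HasDerivAt (fun t => ψ (deriv (cumulant μ) t)) 1 θ := by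
    intro θ hθ
    have := (h.psi _ (mem_image_of_mem _ hθ)).comp θ (hasDerivAt_deriv_cumulant hθ)
    rwa [varianceFun_deriv_cumulant hpos hθ, one_div_mul_cancel (hpos θ hθ).ne'] at this
  have h2 : ∀ θ ∈ canonicalDomain μ,
      HasDerivAt (fun t => φ (deriv (cumulant μ) t)) (deriv (cumulant μ) θ) θ := by
    intro θ hθ
    have := (h.phi _ (mem_image_of_mem _ hθ)).comp θ (hasDerivAt_deriv_cumulant hθ)
    rwa [varianceFun_deriv_cumulant hpos hθ, div_mul_cancel₀ _ (hpos θ hθ).ne'] at this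
  obtain ⟨C₁, hC₁⟩ := exists_eq_add_const_of_hasDerivAt (isOpen_canonicalDomain μ)
    (convex_canonicalDomain μ) h1 fun θ _ => hasDerivAt_id' θ
  obtain ⟨C₂, hC₂⟩ := exists_eq_add_const_of_hasDerivAt (isOpen_canonicalDomain μ)
    (convex_canonicalDomain μ) h2 fun θ hθ => hasDerivAt_cumulant hθ
  exact ⟨C₁, C₂, fun θ hθ => ⟨hC₁ θ hθ, hC₂ θ hθ⟩⟩

/-- A measure with a finite exponential moment is locally finite. -/
lemma isLocallyFiniteMeasure_of_integrable_exp {θ : ℝ}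
    (h : Integrable (fun x => Real.exp (θ * x)) μ) : IsLocallyFiniteMeasure μ := by
  refine ⟨fun x => ⟨Ioo (x - 1) (x + 1), Ioo_mem_nhds (by linarith) (by linarith), ?_⟩⟩
  -- Markov's inequality; the threshold is a lower bound for `exp (θ y)` on the unit ball around
  -- `x`.
  have hfin := h.measure_ge_lt_top (Real.exp_pos (-(|θ| * (|x| + 1))))
  refine lt_of_le_of_lt (measure_mono fun y hy => ?_) hfin
  simp only [mem_ofPred_eq, Real.exp_le_exp]
  have hy' : |y| ≤ |x| + 1 := by
    have := abs_sub_abs_le_abs_sub y x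
    have : |y - x| ≤ 1 := abs_le.2 ⟨by linarith [hy.1], by linarith [hy.2]⟩
    linarith
  calc -(|θ| * (|x| + 1)) ≤ -(|θ| * |y|) := by gcongr
    _ = -|θ * y| := by rw [abs_mul]
    _ ≤ θ * y := neg_abs_le _

end Cumulant

/-! ### Scaling of mean, variance and primitives under powers -/

section Power

variable {μ μp : Measure ℝ} {p : ℝ}

lemma IsPower.eqOn_cumulant (h : IsPower μ p μp) (hμ : μ ≠ 0) :
    EqOn (cumulant μp) (fun θ => p * cumulant μ θ) (canonicalDomain μ) := by
  intro θ hθ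
  have h2 : mgf id μp θ = mgf id μ θ ^ p := h.2 θ hθ
  simp only [cumulant, cgf]
  rw [h2]
  exact Real.log_rpow (laplace_pos hμ hθ) p

lemma IsPower.deriv_cumulant (h : IsPower μ p μp) (hμ : μ ≠ 0) {θ : ℝ}
    (hθ : θ ∈ canonicalDomain μ) : deriv (cumulant μp) θ = p * deriv (cumulant μ) θ := by
  rw [((h.eqOn_cumulant hμ).eventuallyEq_of_mem
    ((isOpen_canonicalDomain μ).mem_nhds hθ)).deriv_eq]
  exact ((hasDerivAt_cumulant hθ).const_mul p).deriv

lemma IsPower.iteratedDeriv_two_cumulant (h : IsPower μ p μp) (hμ : μ ≠ 0) {θ : ℝ}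
    (hθ : θ ∈ canonicalDomain μ) :
    iteratedDeriv 2 (cumulant μp) θ = p * iteratedDeriv 2 (cumulant μ) θ := by
  rw [((h.eqOn_cumulant hμ).eventuallyEq_of_mem
    ((isOpen_canonicalDomain μ).mem_nhds hθ)).iteratedDeriv_eq]
  exact iteratedDeriv_const_mul p (analyticAt_cumulant hθ).contDiffAt

lemma IsPower.meanDomain (h : IsPower μ p μp) (hμ : μ ≠ 0) :
    meanDomain μp = (fun m => p * m) '' meanDomain μ := by
  rw [NEF.meanDomain, NEF.meanDomain, h.1, image_image]
  exact image_congr fun θ hθ => h.deriv_cumulant hμ hθ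

/-- Both `k'` and `k''` are multiplied by `p`, so the variance function of `μp` at `m` is `p V(m /
p)`; the chain rule does the rest. -/
lemma IsPower.isPrimitivePair (h : IsPower μ p μp) (hμ : μ ≠ 0) (hp : 0 < p)
    (hpos : ∀ θ ∈ canonicalDomain μ, 0 < iteratedDeriv 2 (cumulant μ) θ)
    {ψ φ : ℝ → ℝ} (hprim : IsPrimitivePair μ ψ φ) :
    IsPrimitivePair μp (fun m => ψ (m / p)) (fun m => p * φ (m / p)) := by
  have hpos' : ∀ θ ∈ canonicalDomain μp, 0 < iteratedDeriv 2 (cumulant μp) θ := by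
    intro θ hθ
    rw [h.1] at hθ
    rw [h.iteratedDeriv_two_cumulant hμ hθ]
    exact mul_pos hp (hpos θ hθ)
  have hdiv : ∀ m : ℝ, HasDerivAt (fun m => m / p) (1 / p) m := fun m =>
    (hasDerivAt_id' m).div_const p
  have hV : ∀ θ ∈ canonicalDomain μp, deriv (cumulant μp) θ / p = deriv (cumulant μ) θ ∧
      varianceFun μp (deriv (cumulant μp) θ) = p * varianceFun μ (deriv (cumulant μ) θ) := by
    intro θ hθ
    rw [varianceFun_deriv_cumulant hpos' hθ]
    rw [h.1] at hθ
    rw [varianceFun_deriv_cumulant hpos hθ, h.iteratedDeriv_two_cumulant hμ hθ,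
      h.deriv_cumulant hμ hθ]
    exact ⟨mul_div_cancel_left₀ _ hp.ne', rfl⟩
  constructor
  · rintro _ ⟨θ, hθ, rfl⟩
    obtain ⟨hd, hv⟩ := hV θ hθ
    have hm := hprim.psi _ (mem_image_of_mem (deriv (cumulant μ)) (h.1 ▸ hθ))
    have hv0 := hpos θ (h.1 ▸ hθ)
    rw [← hd] at hm
    have := hm.comp (deriv (cumulant μp) θ) (hdiv (deriv (cumulant μp) θ))
    refine this.congr_deriv ?_
    rw [hv, hd, varianceFun_deriv_cumulant hpos (h.1 ▸ hθ)]
    field_simp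
  · rintro _ ⟨θ, hθ, rfl⟩
    obtain ⟨hd, hv⟩ := hV θ hθ
    have hm := hprim.phi _ (mem_image_of_mem (deriv (cumulant μ)) (h.1 ▸ hθ))
    have hv0 := hpos θ (h.1 ▸ hθ)
    rw [← hd] at hm
    have := (hm.comp (deriv (cumulant μp) θ) (hdiv (deriv (cumulant μp) θ))).const_mul p
    refine this.congr_deriv ?_
    rw [hv, hd, h.deriv_cumulant hμ (h.1 ▸ hθ), varianceFun_deriv_cumulant hpos (h.1 ▸ hθ)]
    field_simp

end Power

/-! ### Exponential tilting -/

section Tilt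

/-- The measure `exp (a x + b) μ(dx)`. -/
noncomputable def tilt (a b : ℝ) (μ : Measure ℝ) : Measure ℝ :=
  μ.withDensity fun x => ENNReal.ofReal (Real.exp (a * x + b))

variable {μ : Measure ℝ} (a b : ℝ)

lemma measurable_tilt_density : Measurable fun x : ℝ => ENNReal.ofReal (Real.exp (a * x + b)) := by
  fun_prop

lemma withDensity_tilt (c d : ℝ) :
    (tilt a b μ).withDensity (fun x => ENNReal.ofReal (Real.exp (c * x + d))) =
      tilt (a + c) (b + d) μ := by
  rw [tilt, tilt, ← withDensity_mul _ (measurable_tilt_density a b) (measurable_tilt_density c d)]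
  congr 1
  ext x
  rw [Pi.mul_apply, ← ENNReal.ofReal_mul (Real.exp_pos _).le, ← Real.exp_add]
  congr 2
  ring

lemma tilt_zero (μ : Measure ℝ) : tilt 0 0 μ = μ := by simp [tilt]

lemma tilt_tilt_neg : tilt (-a) (-b) (tilt a b μ) = μ := by
  conv_lhs => rw [tilt]
  rw [withDensity_tilt, add_neg_cancel, add_neg_cancel, tilt_zero]

lemma tilt_singleton (x : ℝ) :
    tilt a b μ {x} = ENNReal.ofReal (Real.exp (a * x + b)) * μ {x} := by
  rw [tilt, withDensity_apply _ (measurableSet_singleton x), lintegral_singleton]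

lemma tilt_absolutelyContinuous : tilt a b μ ≪ μ := withDensity_absolutelyContinuous _ _

lemma IsCounting.tilt (h : IsCounting μ) : IsCounting (tilt a b μ) :=
  tilt_absolutelyContinuous a b h

lemma integrable_tilt_iff (g : ℝ → ℝ) :
    Integrable g (tilt a b μ) ↔ Integrable (fun x => g x * Real.exp (a * x + b)) μ := by
  rw [tilt, integrable_withDensity_iff (measurable_tilt_density a b)
    (Eventually.of_forall fun _ => ENNReal.ofReal_lt_top)]
  simp [ENNReal.toReal_ofReal, (Real.exp_pos _).le]

lemma mem_integrableExpSet_tilt {θ : ℝ} :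
    θ ∈ integrableExpSet id (tilt a b μ) ↔ θ + a ∈ integrableExpSet id μ := by
  simp only [integrableExpSet, mem_ofPred_eq, id, integrable_tilt_iff]
  have : (fun x : ℝ => Real.exp (θ * x) * Real.exp (a * x + b)) =
      fun x => Real.exp b * Real.exp ((θ + a) * x) := by
    ext x
    rw [← Real.exp_add, ← Real.exp_add]
    ring_nf
  rw [this, integrable_const_mul_iff (Real.exp_pos b).ne'.isUnit]

lemma mem_canonicalDomain_tilt {θ : ℝ} :
    θ ∈ canonicalDomain (tilt a b μ) ↔ θ + a ∈ canonicalDomain μ := by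
  have : integrableExpSet id (tilt a b μ) =
      (Homeomorph.addRight a) ⁻¹' integrableExpSet id μ := by
    ext θ
    exact mem_integrableExpSet_tilt a b
  rw [canonicalDomain, canonicalDomain, this, ← Homeomorph.preimage_interior]
  rfl

lemma mgf_tilt (θ : ℝ) : mgf id (tilt a b μ) θ = Real.exp b * mgf id μ (θ + a) := by
  rw [mgf, mgf, tilt, integral_withDensity_eq_integral_toReal_smul
    (measurable_tilt_density a b) (Eventually.of_forall fun _ => ENNReal.ofReal_lt_top),
    ← integral_const_mul]
  refine integral_congr_ae (Eventually.of_forall fun x => ?_)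
  simp only [ENNReal.toReal_ofReal (Real.exp_pos _).le, smul_eq_mul, ← Real.exp_add, id]
  ring_nf

lemma cumulant_tilt (hμ : μ ≠ 0) {θ : ℝ} (hθ : θ + a ∈ canonicalDomain μ) :
    cumulant (tilt a b μ) θ = cumulant μ (θ + a) + b := by
  have : mgf id μ (θ + a) ≠ 0 := (laplace_pos hμ hθ).ne'
  rw [cumulant, cgf, mgf_tilt, Real.log_mul (Real.exp_pos b).ne' this, Real.log_exp, add_comm]
  rfl

lemma isGenerating_tilt (h : (canonicalDomain μ).Nonempty) : IsGenerating (tilt a b μ) := by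
  obtain ⟨θ, hθ⟩ := h
  have : θ - a ∈ canonicalDomain (tilt a b μ) := by
    rw [mem_canonicalDomain_tilt]
    simpa
  exact ⟨isLocallyFiniteMeasure_of_integrable_exp (integrable_of_mem_canonicalDomain this), _, this⟩

lemma nef_eq_image_tilt (μ : Measure ℝ) :
    nef μ = (fun θ => tilt θ (-cumulant μ θ) μ) '' canonicalDomain μ := by
  rw [nef]
  exact image_congr fun θ _ => by simp only [tilt, sub_eq_add_neg]

/-- Equivalent generating measures generate the same natural exponential family. -/
lemma nef_tilt (hμ : μ ≠ 0) : nef (tilt a b μ) = nef μ := by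
  have key : ∀ θ, θ + a ∈ canonicalDomain μ →
      tilt θ (-cumulant (tilt a b μ) θ) (tilt a b μ) =
        tilt (θ + a) (-cumulant μ (θ + a)) μ := by
    intro θ hθ
    conv_lhs => rw [tilt, withDensity_tilt, cumulant_tilt a b hμ hθ]
    congr 1 <;> ring
  rw [nef_eq_image_tilt, nef_eq_image_tilt]
  ext ρ
  constructor
  · rintro ⟨θ, hθ, rfl⟩
    rw [mem_canonicalDomain_tilt] at hθ
    exact ⟨θ + a, hθ, (key θ hθ).symm⟩
  · rintro ⟨θ, hθ, rfl⟩
    refine ⟨θ - a, (mem_canonicalDomain_tilt a b).2 (by simpa using hθ), ?_⟩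
    simp only
    rw [key _ (by simpa using hθ), sub_add_cancel]

lemma meanFamily_tilt {ψ φ : ℝ → ℝ} {C₁ C₂ : ℝ}
    (h : ∀ θ ∈ canonicalDomain μ,
      ψ (deriv (cumulant μ) θ) = θ + C₁ ∧ φ (deriv (cumulant μ) θ) = cumulant μ θ + C₂) :
    meanFamily ψ φ (tilt (-C₁) C₂ μ) (meanDomain μ) = nef μ := by
  rw [nef_eq_image_tilt, meanFamily, meanDomain, image_image]
  refine image_congr fun θ hθ => ?_
  obtain ⟨h1, h2⟩ := h θ hθ
  rw [h1, h2]
  have := withDensity_tilt (μ := μ) (-C₁) C₂ (θ + C₁) (-(cumulant μ θ + C₂))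
  simp only [mul_comm _ (θ + C₁), sub_eq_add_neg]
  rw [this]
  congr 1 <;> ring

end Tilt

/-! ### Uniqueness of Laplace transforms -/

section Uniqueness

lemma isFiniteMeasure_tilt {μ : Measure ℝ} {t : ℝ} (h : t ∈ integrableExpSet id μ) :
    IsFiniteMeasure (tilt t 0 μ) := by
  have : Integrable (fun _ => (1 : ℝ)) (tilt t 0 μ) := by
    rw [integrable_tilt_iff]
    simpa using! h
  exact (integrable_const_iff_isFiniteMeasure one_ne_zero).1 this

lemma complexMGF_tilt {μ : Measure ℝ} (t y : ℝ) :
    complexMGF id (tilt t 0 μ) (y * Complex.I) = complexMGF id μ (t + y * Complex.I) := by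
  rw [complexMGF, complexMGF, tilt, integral_withDensity_eq_integral_toReal_smul
    (measurable_tilt_density t 0) (Eventually.of_forall fun _ => ENNReal.ofReal_lt_top)]
  refine integral_congr_ae (Eventually.of_forall fun x => ?_)
  simp only [ENNReal.toReal_ofReal (Real.exp_pos _).le, Complex.real_smul, id, add_zero,
    Complex.ofReal_exp, ← Complex.exp_add]
  congr 1
  push_cast
  ring

/-- Two measures whose Laplace transforms are finite and agree on a nonempty open interval are
equal. -/
lemma ext_of_mgf_eqOn {A B : Measure ℝ} {s : Set ℝ} (hs : IsOpen s) (hc : Convex ℝ s)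
    (hne : s.Nonempty) (hA : s ⊆ integrableExpSet id A) (hB : s ⊆ integrableExpSet id B)
    (h : EqOn (mgf id A) (mgf id B) s) : A = B := by
  obtain ⟨t, ht⟩ := hne
  have hA' : AnalyticOnNhd ℂ (complexMGF id A) {z | z.re ∈ s} :=
    analyticOnNhd_complexMGF.mono fun z hz => interior_maximal hA hs hz
  have hB' : AnalyticOnNhd ℂ (complexMGF id B) {z | z.re ∈ s} :=
    analyticOnNhd_complexMGF.mono fun z hz => interior_maximal hB hs hz
  -- Identity theorem on the vertical strip over `s`: real points accumulate at `t`.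
  have heq : EqOn (complexMGF id A) (complexMGF id B) {z | z.re ∈ s} := by
    refine hA'.eqOn_of_preconnected_of_frequently_eq hB'
      (hc.linear_preimage Complex.reLm).isPreconnected (z₀ := (t : ℂ)) (by simpa using ht) ?_
    have htend : Tendsto (fun x : ℝ => (x : ℂ)) (𝓝[≠] t) (𝓝[≠] (t : ℂ)) :=
      Complex.continuous_ofReal.continuousAt.continuousWithinAt.tendsto_nhdsWithin
        fun x hx => by simpa using hx
    refine htend.frequently (Eventually.frequently ?_)
    filter_upwards [nhdsWithin_le_nhds (hs.mem_nhds ht)] with x hx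
    rw [complexMGF_ofReal, complexMGF_ofReal, h hx]
  have := isFiniteMeasure_tilt (hA ht)
  have := isFiniteMeasure_tilt (hB ht)
  -- On the line of real part `t` the complex transforms are the characteristic functions of the
  -- tilted measures, which are finite.
  have htilt : tilt t 0 A = tilt t 0 B := by
    refine Measure.ext_of_charFun (funext fun y => ?_)
    rw [← complexMGF_id_mul_I, ← complexMGF_id_mul_I, complexMGF_tilt, complexMGF_tilt]
    exact heq (by simpa using ht)
  rw [← tilt_tilt_neg t 0 (μ := A), htilt, tilt_tilt_neg]

end Uniqueness

/-! ### Measures on the nonnegative integers and generating functions -/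

section GeneratingFunction

/-- The measure on the nonnegative integers with masses `c n`. -/
noncomputable def discrete (c : ℕ → ENNReal) : Measure ℝ :=
  Measure.sum fun n => c n • Measure.dirac (n : ℝ)

lemma isCounting_discrete (c : ℕ → ENNReal) : IsCounting (discrete c) := by
  have hm : MeasurableSet (range ((↑) : ℕ → ℝ))ᶜ :=
    (countable_range _).measurableSet.compl
  rw [IsCounting, discrete, Measure.sum_apply _ hm]
  simp [Measure.dirac_apply' _ hm]

lemma IsCounting.eq_discrete {ν : Measure ℝ} (h : IsCounting ν) :
    ν = discrete fun n => ν {(n : ℝ)} := by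
  have hr : range ((↑) : ℕ → ℝ) = ⋃ n : ℕ, {(n : ℝ)} := by
    ext x
    simp [eq_comm]
  have h1 : ν.restrict (range ((↑) : ℕ → ℝ)) = ν :=
    Measure.restrict_eq_self_of_ae_mem (mem_ae_iff.2 h)
  conv_lhs => rw [← h1, hr]
  rw [Measure.restrict_iUnion (fun i j hij => by simpa using hij)
    fun n => measurableSet_singleton _]
  simp only [Measure.restrict_singleton]
  rfl

lemma exp_mul_natCast (θ : ℝ) (n : ℕ) : Real.exp (θ * n) = Real.exp θ ^ n := by
  rw [mul_comm, Real.exp_nat_mul]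

lemma mem_integrableExpSet_discrete {c : ℕ → ENNReal} (hc : ∀ n, c n ≠ ⊤) {θ : ℝ} :
    θ ∈ integrableExpSet id (discrete c) ↔
      Summable fun n => (c n).toReal * Real.exp θ ^ n := by
  simp only [integrableExpSet, discrete, mem_ofPred_eq, integrable_sum_dirac_iff hc, id,
    exp_mul_natCast, Real.norm_eq_abs, abs_of_pos (pow_pos (Real.exp_pos θ) _)]

lemma mgf_discrete {c : ℕ → ENNReal} (hc : ∀ n, c n ≠ ⊤) (θ : ℝ) :
    mgf id (discrete c) θ = ∑' n, (c n).toReal * Real.exp θ ^ n := by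
  simp only [mgf, discrete, integral_sum_dirac hc, id, exp_mul_natCast, smul_eq_mul]

/-- The generating function `∑ ν_n z ^ n` of a measure on the nonnegative integers. -/
noncomputable def genFun (ν : Measure ℝ) (z : ℝ) : ℝ := ∑' n : ℕ, ν.real {(n : ℝ)} * z ^ n

variable {ν : Measure ℝ}

lemma measure_singleton_ne_top (hne : (canonicalDomain ν).Nonempty) (x : ℝ) : ν {x} ≠ ⊤ := by
  obtain ⟨θ, hθ⟩ := hne
  have := isLocallyFiniteMeasure_of_integrable_exp (integrable_of_mem_canonicalDomain hθ)
  exact (isCompact_singleton.measure_lt_top).ne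

lemma IsCounting.summable (h : IsCounting ν) {θ : ℝ} (hθ : θ ∈ canonicalDomain ν) :
    Summable fun n : ℕ => ν.real {(n : ℝ)} * Real.exp θ ^ n := by
  have h1 := interior_subset hθ
  rw [h.eq_discrete] at h1
  exact (mem_integrableExpSet_discrete fun n => measure_singleton_ne_top ⟨θ, hθ⟩ _).1 h1

lemma IsCounting.genFun_exp (h : IsCounting ν) {θ : ℝ} (hθ : θ ∈ canonicalDomain ν) :
    genFun ν (Real.exp θ) = laplace ν θ := by
  conv_rhs => rw [laplace, h.eq_discrete]
  rw [mgf_discrete fun n => measure_singleton_ne_top ⟨θ, hθ⟩ _]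
  rfl

/-- On nonnegative `x`, `exp (θ x)` increases with `θ`. Hence `log z` lies in the domain for all
small `z > 0`, which lets germs at `z = 0` be compared. -/
lemma IsCounting.isLowerSet_canonicalDomain (h : IsCounting ν) :
    IsLowerSet (canonicalDomain ν) := by
  refine IsLowerSet.interior fun θ θ' hle hθ => ?_
  refine Integrable.mono' hθ (by fun_prop) ?_
  have : ∀ᵐ x ∂ν, x ∈ range ((↑) : ℕ → ℝ) := mem_ae_iff.2 h
  filter_upwards [this] with x hx
  obtain ⟨n, rfl⟩ := hx
  rw [Real.norm_eq_abs, Real.abs_exp]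
  simp only [id]
  gcongr

lemma IsCounting.eventually_log_mem (h : IsCounting ν) (hne : (canonicalDomain ν).Nonempty) :
    ∀ᶠ z in 𝓝[>] (0 : ℝ), Real.log z ∈ canonicalDomain ν := by
  obtain ⟨θ, hθ⟩ := hne
  filter_upwards [Ioo_mem_nhdsGT (Real.exp_pos θ)] with z hz
  exact h.isLowerSet_canonicalDomain ((Real.log_lt_iff_lt_exp hz.1).2 hz.2).le hθ

lemma IsCounting.hasFPowerSeriesAt_genFun (h : IsCounting ν)
    (hne : (canonicalDomain ν).Nonempty) :
    HasFPowerSeriesAt (genFun ν)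
      (FormalMultilinearSeries.ofScalars ℝ fun n : ℕ => ν.real {(n : ℝ)}) 0 := by
  obtain ⟨θ, hθ⟩ := hne
  rw [hasFPowerSeriesAt_iff]
  filter_upwards [Ioo_mem_nhds (neg_neg_of_pos (Real.exp_pos θ)) (Real.exp_pos θ)] with z hz
  have hz' : |z| ≤ Real.exp θ := (abs_lt.2 hz).le
  have hs : Summable fun n : ℕ => ν.real {(n : ℝ)} * z ^ n := by
    refine Summable.of_norm_bounded (h.summable hθ) fun n => ?_
    rw [norm_mul, norm_pow, Real.norm_eq_abs, Real.norm_eq_abs, abs_of_nonneg measureReal_nonneg]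
    gcongr
  simpa only [FormalMultilinearSeries.coeff_ofScalars, zero_add, smul_eq_mul, mul_comm (z ^ _)]
    using! hs.hasSum

lemma IsCounting.analyticAt_genFun (h : IsCounting ν) (hne : (canonicalDomain ν).Nonempty) :
    AnalyticAt ℝ (genFun ν) 0 := (h.hasFPowerSeriesAt_genFun hne).analyticAt

lemma IsCounting.iteratedDeriv_genFun (h : IsCounting ν) (hne : (canonicalDomain ν).Nonempty)
    (n : ℕ) : iteratedDeriv n (genFun ν) 0 = n.factorial * ν.real {(n : ℝ)} := by
  have h1 := (h.analyticAt_genFun hne).hasFPowerSeriesAt.eq_formalMultilinearSeries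
    (h.hasFPowerSeriesAt_genFun hne)
  have h2 := congrArg (fun p => FormalMultilinearSeries.coeff p n) h1
  simp only [FormalMultilinearSeries.coeff_ofScalars] at h2
  rw [← h2]
  field_simp

lemma IsCounting.genFun_zero (h : IsCounting ν) (hne : (canonicalDomain ν).Nonempty) :
    genFun ν 0 = ν.real {0} := by
  simpa using h.iteratedDeriv_genFun hne 0

lemma IsCounting.deriv_genFun_zero (h : IsCounting ν) (hne : (canonicalDomain ν).Nonempty) :
    deriv (genFun ν) 0 = ν.real {1} := by
  simpa [iteratedDeriv_one] using h.iteratedDeriv_genFun hne 1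

end GeneratingFunction

/-! ### Powers stay on the nonnegative integers -/

section PowerCounting

variable {μ μp : Measure ℝ} {p : ℝ}

lemma analyticAt_rpow_const {f : ℝ → ℝ} {x : ℝ} (hf : AnalyticAt ℝ f x) (h0 : f x ≠ 0) (p : ℝ) :
    AnalyticAt ℝ (fun z => f z ^ p) x :=
  (ContDiffAt.rpow_const_of_ne hf.contDiffAt h0).analyticAt

/-- If a power of the Laplace transform of a measure on the nonnegative integers charging `0` is
the Laplace transform of a measure, then that measure lives on the nonnegative integers. -/
lemma IsPower.isCounting (h : IsPower μ p μp) (hcount : IsCounting μ)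
    (hne : (canonicalDomain μ).Nonempty) (h0 : 0 < μ {0}) : IsCounting μp := by
  have hf := hcount.analyticAt_genFun hne
  have hf0 : genFun μ 0 ≠ 0 := by
    rw [hcount.genFun_zero hne]
    exact (ENNReal.toReal_pos h0.ne' (measure_singleton_ne_top hne 0)).ne'
  obtain ⟨q, hq⟩ := analyticAt_rpow_const hf hf0 p
  rw [hasFPowerSeriesAt_iff] at hq
  set b : ℕ → ℝ := fun n => q.coeff n with hb
  obtain ⟨r, hr0, hr⟩ : ∃ r > 0, ∀ z ∈ Ioo (0 : ℝ) r, Real.log z ∈ canonicalDomain μ ∧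
      HasSum (fun n => b n * z ^ n) (genFun μ z ^ p) := by
    have hev := (hcount.eventually_log_mem hne).and (hq.filter_mono nhdsWithin_le_nhds)
    obtain ⟨r, hr0, hr⟩ := mem_nhdsGT_iff_exists_Ioo_subset.1 hev
    refine ⟨r, hr0, fun z hz => ⟨(hr hz).1, ?_⟩⟩
    simpa only [zero_add, smul_eq_mul, mul_comm (z ^ _)] using (hr hz).2
  -- The signs of the Taylor coefficients `b n` are not known yet. `ENNReal.ofReal` truncates at 0,
  -- so `P` and `N` carry their positive and negative parts, and `μp + N = P` is an identity of
  -- positive measures.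
  set P := discrete fun n => ENNReal.ofReal (b n) with hP
  set N := discrete fun n => ENNReal.ofReal (-b n) with hN
  have hθ : ∀ θ ∈ Iio (Real.log r), θ ∈ canonicalDomain μ ∧
      HasSum (fun n => b n * Real.exp θ ^ n) (genFun μ (Real.exp θ) ^ p) := by
    intro θ hθ
    have := hr (Real.exp θ) ⟨Real.exp_pos θ, (Real.lt_log_iff_exp_lt hr0).1 hθ⟩
    rwa [Real.log_exp] at this
  have hsum : ∀ θ ∈ Iio (Real.log r), ∀ ε : ℝ, |ε| = 1 →
      Summable fun n => (ENNReal.ofReal (ε * b n)).toReal * Real.exp θ ^ n := by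
    intro θ hθ' ε hε
    refine Summable.of_norm_bounded (hθ θ hθ').2.summable.abs fun n => ?_
    rw [Real.norm_eq_abs, abs_mul, abs_mul]
    refine mul_le_mul_of_nonneg_right ?_ (abs_nonneg _)
    rw [abs_of_nonneg ENNReal.toReal_nonneg, ENNReal.toReal_ofReal']
    refine max_le ((le_abs_self _).trans_eq ?_) (abs_nonneg _)
    rw [abs_mul, hε, one_mul]
  have hsP : ∀ θ ∈ Iio (Real.log r),
      Summable fun n => (ENNReal.ofReal (b n)).toReal * Real.exp θ ^ n := fun θ h => by
    simpa using hsum θ h 1 (by simp)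
  have hsN : ∀ θ ∈ Iio (Real.log r),
      Summable fun n => (ENNReal.ofReal (-b n)).toReal * Real.exp θ ^ n := fun θ h => by
    simpa using hsum θ h (-1) (by simp)
  have hIP : Iio (Real.log r) ⊆ integrableExpSet id P := fun θ h =>
    (mem_integrableExpSet_discrete fun n => ENNReal.ofReal_ne_top).2 (hsP θ h)
  have hIN : Iio (Real.log r) ⊆ integrableExpSet id N := fun θ h =>
    (mem_integrableExpSet_discrete fun n => ENNReal.ofReal_ne_top).2 (hsN θ h)
  have hIp : Iio (Real.log r) ⊆ integrableExpSet id μp := fun θ hθ' =>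
    interior_subset (h.1.symm ▸ (hθ θ hθ').1 : θ ∈ canonicalDomain μp)
  have key : μp + N = P := by
    refine ext_of_mgf_eqOn isOpen_Iio (convex_Iio _) nonempty_Iio
      (fun θ hθ => (hIp hθ).add_measure (hIN hθ)) hIP fun θ hθ' => ?_
    have e1 : mgf id (μp + N) θ = mgf id μp θ + mgf id N θ :=
      integral_add_measure (hIp hθ') (hIN hθ')
    have e2 : mgf id μp θ = ∑' n, b n * Real.exp θ ^ n := by
      rw [(hθ θ hθ').2.tsum_eq, hcount.genFun_exp (hθ θ hθ').1]
      exact h.2 θ (hθ θ hθ').1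
    rw [e1, e2, mgf_discrete fun n => ENNReal.ofReal_ne_top,
      mgf_discrete fun n => ENNReal.ofReal_ne_top,
      ← (hθ θ hθ').2.summable.tsum_add (hsN θ hθ')]
    refine tsum_congr fun n => ?_
    rw [← add_mul]
    congr 1
    rw [ENNReal.toReal_ofReal', ENNReal.toReal_ofReal']
    rcases le_total (b n) 0 with hn | hn
    · rw [max_eq_left (by linarith), max_eq_right hn]; ring
    · rw [max_eq_right (by linarith), max_eq_left hn]; ring
  have hPc : IsCounting P := isCounting_discrete _
  -- Since `μp ≤ P`, every null set of `P` is null for `μp`.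
  rw [IsCounting, ← key, Measure.add_apply, add_eq_zero] at hPc
  exact hPc.1

lemma IsPower.atoms_pos (h : IsPower μ p μp) (hp : 0 < p) (hcount : IsCounting μ)
    (hne : (canonicalDomain μ).Nonempty) (h0 : 0 < μ {0}) (h1 : 0 < μ {1}) :
    0 < μp {0} ∧ 0 < μp {1} := by
  have hcount' := h.isCounting hcount hne h0
  have hne' : (canonicalDomain μp).Nonempty := h.1.symm ▸ hne
  have hf := hcount.analyticAt_genFun hne
  have hf0 : 0 < genFun μ 0 := by
    rw [hcount.genFun_zero hne]
    exact ENNReal.toReal_pos h0.ne' (measure_singleton_ne_top hne 0)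
  have hf1 : 0 < deriv (genFun μ) 0 := by
    rw [hcount.deriv_genFun_zero hne]
    exact ENNReal.toReal_pos h1.ne' (measure_singleton_ne_top hne 1)
  -- The Laplace transforms give equality only for small `z > 0`; analyticity extends it across 0,
  -- where value and derivative are read off.
  have heq : genFun μp =ᶠ[𝓝 0] fun z => genFun μ z ^ p := by
    refine (AnalyticAt.frequently_eq_iff_eventually_eq (hcount'.analyticAt_genFun hne')
      (analyticAt_rpow_const hf hf0.ne' p)).1 ?_
    refine Frequently.filter_mono (f := 𝓝[>] (0 : ℝ)) (Eventually.frequently ?_)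
      (nhdsWithin_mono _ fun x hx => ne_of_gt hx)
    filter_upwards [hcount.eventually_log_mem hne, self_mem_nhdsWithin] with z hz hz0
    have e1 := hcount'.genFun_exp (h.1.symm ▸ hz : Real.log z ∈ canonicalDomain μp)
    have e2 := hcount.genFun_exp hz
    rw [Real.exp_log hz0] at e1 e2
    rw [e1, e2, h.2 _ hz]
  have hd := (hf.differentiableAt.hasDerivAt.rpow_const (p := p) (Or.inl hf0.ne')).deriv
  constructor
  · have : 0 < μp.real {0} := by
      rw [← hcount'.genFun_zero hne', heq.eq_of_nhds]
      exact Real.rpow_pos_of_pos hf0 p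
    exact (ENNReal.toReal_pos_iff.1 this).1
  · have : 0 < μp.real {1} := by
      rw [← hcount'.deriv_genFun_zero hne', heq.deriv_eq, hd]
      have := Real.rpow_pos_of_pos hf0 (p - 1)
      positivity
    exact (ENNReal.toReal_pos_iff.1 this).1

end PowerCounting

/-! ### The masses by Lagrange inversion -/

section LetacMora

variable {ν : Measure ℝ}

/-- In the coordinate `z = exp θ`, the mean map of a measure on the nonnegative integers is
`z h'(z) / h(z)` where `h` is the generating function. -/
lemma IsCounting.eventually_cumulant_log (h : IsCounting ν) (hne : (canonicalDomain ν).Nonempty)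
    (h0 : 0 < ν {0}) :
    ∀ᶠ z in 𝓝[>] (0 : ℝ), Real.log z ∈ canonicalDomain ν ∧ 0 < genFun ν z ∧
      cumulant ν (Real.log z) = Real.log (genFun ν z) ∧
      deriv (cumulant ν) (Real.log z) = z * (deriv (genFun ν) z / genFun ν z) := by
  have hν := ne_zero_of_atom h0
  filter_upwards [h.eventually_log_mem hne, self_mem_nhdsWithin,
    nhdsWithin_le_nhds (h.analyticAt_genFun hne).eventually_analyticAt] with z hz hz0 hza
  have hcum : ∀ θ ∈ canonicalDomain ν, cumulant ν θ = Real.log (genFun ν (Real.exp θ)) := by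
    intro θ hθ
    rw [h.genFun_exp hθ]
    rfl
  have hpos : 0 < genFun ν z := by
    have := h.genFun_exp hz
    rw [Real.exp_log hz0] at this
    rw [this]
    exact laplace_pos hν hz
  refine ⟨hz, hpos, by rw [hcum _ hz, Real.exp_log hz0], ?_⟩
  have heq : cumulant ν =ᶠ[𝓝 (Real.log z)] fun θ => Real.log (genFun ν (Real.exp θ)) :=
    eventually_of_mem ((isOpen_canonicalDomain ν).mem_nhds hz) hcum
  have he : Real.exp (Real.log z) = z := Real.exp_log hz0
  have hd : HasDerivAt (fun θ => genFun ν (Real.exp θ)) (deriv (genFun ν) z * z) (Real.log z) := by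
    have h1 : HasDerivAt (genFun ν) (deriv (genFun ν) z) (Real.exp (Real.log z)) := by
      rw [he]
      exact hza.differentiableAt.hasDerivAt
    have h2 := Real.hasDerivAt_exp (Real.log z)
    rw [he] at h2
    exact h1.comp (Real.log z) h2
  rw [heq.deriv_eq, (hd.log (by rw [he]; exact hpos.ne')).deriv, he]
  ring

/-- A measure on the nonnegative integers charging `0` and `1`, for which `ψ` and `φ` are the
canonical parameter and the cumulant transform as functions of the mean, has the masses given by
Lagrange inversion. -/
lemma IsCounting.isLetacMora (h : IsCounting ν) (hne : (canonicalDomain ν).Nonempty)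
    (h0 : 0 < ν {0}) (h1 : 0 < ν {1}) {ψ φ : ℝ → ℝ}
    (hpar : ∀ θ ∈ canonicalDomain ν,
      ψ (deriv (cumulant ν) θ) = θ ∧ φ (deriv (cumulant ν) θ) = cumulant ν θ) :
    IsLetacMora ψ φ ν := by
  set f := genFun ν with hf
  have hfa : AnalyticAt ℝ f 0 := h.analyticAt_genFun hne
  have hf0 : 0 < f 0 := by
    rw [hf, h.genFun_zero hne]
    exact ENNReal.toReal_pos h0.ne' (measure_singleton_ne_top hne 0)
  have hf1 : 0 < deriv f 0 := by
    rw [hf, h.deriv_genFun_zero hne]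
    exact ENNReal.toReal_pos h1.ne' (measure_singleton_ne_top hne 1)
  set u : ℝ → ℝ := fun z => deriv f z / f z with hu
  have hua : AnalyticAt ℝ u 0 := hfa.deriv.fun_div hfa hf0.ne'
  have hu0 : 0 < u 0 := div_pos hf1 hf0
  set m : ℝ → ℝ := fun z => z * u z with hm
  have hma : AnalyticAt ℝ m 0 := analyticAt_id.fun_mul hua
  have hm0 : m 0 = 0 := by simp [hm]
  have hmd : deriv m 0 ≠ 0 := by
    have : deriv m 0 = u 0 := by
      simpa using ((hasDerivAt_id' (0 : ℝ)).fun_mul hua.differentiableAt.hasDerivAt).deriv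
    rw [this]
    exact hu0.ne'
  obtain ⟨ζ, hζa, hζ0, hmζ, hζm⟩ := exists_analyticAt_inverse hma hm0 hmd
  have hζt : Tendsto ζ (𝓝 0) (𝓝 0) := by
    have := hζa.continuousAt.tendsto
    rwa [hζ0] at this
  have hmt : Tendsto m (𝓝 0) (𝓝 0) := by
    have := hma.continuousAt.tendsto
    rwa [hm0] at this
  have hupos : ∀ᶠ z in 𝓝 0, 0 < u z := hua.continuousAt.eventually (lt_mem_nhds hu0)
  -- Positivity makes `log (ζ x)` a genuine canonical parameter, the one with mean `x`.
  have hζpos : ∀ᶠ x in 𝓝[>] (0 : ℝ), 0 < ζ x := by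
    filter_upwards [nhdsWithin_le_nhds hmζ, nhdsWithin_le_nhds (hζt.eventually hupos),
      self_mem_nhdsWithin] with x hx hux hx0
    rw [← hx] at hx0
    exact pos_of_mul_pos_left hx0 hux.le
  have hζt' : Tendsto ζ (𝓝[>] 0) (𝓝[>] 0) :=
    tendsto_nhdsWithin_iff.2 ⟨hζt.mono_left nhdsWithin_le_nhds, hζpos⟩
  have hval : ∀ᶠ x in 𝓝[>] (0 : ℝ), 0 < ζ x ∧ 0 < f (ζ x) ∧ m (ζ x) = x ∧
      ψ x = Real.log (ζ x) ∧ φ x = Real.log (f (ζ x)) := by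
    filter_upwards [hζpos, nhdsWithin_le_nhds hmζ,
      hζt'.eventually (h.eventually_cumulant_log hne h0)] with x hx hmx ⟨hmem, hpos, hk, hk'⟩
    have hk'' : deriv (cumulant ν) (Real.log (ζ x)) = x := hk'.trans hmx
    obtain ⟨e1, e2⟩ := hpar _ hmem
    rw [hk''] at e1 e2
    exact ⟨hx, hpos, hmx, e1, e2.trans hk⟩
  have hcomp : AnalyticAt ℝ (fun x => f (ζ x)) 0 :=
    AnalyticAt.fun_comp (by rwa [hζ0]) hζa
  have hucomp : AnalyticAt ℝ (fun x => u (ζ x)) 0 :=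
    AnalyticAt.fun_comp (by rwa [hζ0]) hζa
  refine ⟨h, fun n => measure_singleton_ne_top hne _, ?_, ?_⟩
  · refine ⟨fun x => f (ζ x), hcomp, ?_, ?_⟩
    · filter_upwards [hval] with x ⟨_, hpos, _, _, hφ⟩
      rw [hφ, Real.exp_log hpos]
    · rw [iteratedDeriv_zero, hζ0, hf, h.genFun_zero hne]
  · rintro n hn
    obtain ⟨k, rfl⟩ : ∃ k, n = k + 1 := ⟨n - 1, by omega⟩
    -- The continuation of `exp φ * φ' * G ^ n` through 0: `exp φ * φ'` is the derivative of `exp φ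
    -- = f ∘ ζ`.
    set g : ℝ → ℝ := fun x => deriv (fun x => f (ζ x)) x * u (ζ x) ^ (k + 1) with hg
    have hga : AnalyticAt ℝ g 0 := hcomp.deriv.fun_mul (hucomp.fun_pow _)
    refine ⟨iteratedDeriv k g 0, ⟨g, hga, ?_, by simp⟩, ?_⟩
    · filter_upwards [hval, eventually_eventually_nhdsWithin.2 hval, self_mem_nhdsWithin,
        nhdsWithin_le_nhds hcomp.eventually_analyticAt] with x ⟨hz, hpos, hmx, hψ, hφ⟩ hev hx hxa
      rw [isOpen_Ioi.nhdsWithin_eq hx] at hev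
      have hφd : deriv φ x = deriv (fun x => f (ζ x)) x / f (ζ x) := by
        have : φ =ᶠ[𝓝 x] fun x => Real.log (f (ζ x)) := hev.mono fun y hy => hy.2.2.2.2
        rw [this.deriv_eq, (hxa.differentiableAt.hasDerivAt.log hpos.ne').deriv]
      have hG : letacMoraG ψ x = u (ζ x) := by
        rw [letacMoraG, hψ, Real.exp_neg, Real.exp_log hz]
        nth_rewrite 1 [← hmx]
        simp only [hm]
        field_simp
      rw [hφd, hG, hφ, Real.exp_log hpos, mul_div_cancel₀ _ hpos.ne']
    -- Substituting `x = m(z)`, the powers of `u` cancel and the chain rule leaves `f'`, whose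
    -- `k`-th derivative at 0 is `n! ν_n` as `n = k + 1`.
    · have key : (fun z => g (z * u z) * (deriv m z * (u z)⁻¹ ^ (k + 1))) =ᶠ[𝓝 0] deriv f := by
        filter_upwards [hζm, eventually_eventually_nhds.2 hζm, hupos,
          hmt.eventually hcomp.eventually_analyticAt, hma.eventually_analyticAt]
          with z hz hev huz hca hza
        have hchain : deriv (fun x => f (ζ x)) (m z) * deriv m z = deriv f z := by
          have e : (fun z => f (ζ (m z))) =ᶠ[𝓝 z] f := hev.mono fun y hy => congrArg f hy
          rw [← e.deriv_eq]
          exact (hca.differentiableAt.hasDerivAt.comp z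
            hza.differentiableAt.hasDerivAt).deriv.symm
        change deriv (fun x => f (ζ x)) (m z) * u (ζ (m z)) ^ (k + 1) *
          (deriv m z * (u z)⁻¹ ^ (k + 1)) = _
        rw [hz, ← hchain, inv_pow]
        field_simp
      rw [← iteratedDeriv_comp_mul_deriv_mul_inv_pow hua hu0.ne' k hga, key.iteratedDeriv_eq,
        ← iteratedDeriv_succ', hf, h.iteratedDeriv_genFun hne]
      field_simp

/-- The natural exponential family of a measure on the nonnegative integers charging `0` and `1`
is generated by the measure with the Letac-Mora masses. -/
theorem exists_isLetacMora {μ : Measure ℝ} (h : IsCounting μ)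
    (hne : (canonicalDomain μ).Nonempty) (h0 : 0 < μ {0}) (h1 : 0 < μ {1}) {ψ φ : ℝ → ℝ}
    (hprim : IsPrimitivePair μ ψ φ) :
    ∃ ν : Measure ℝ, IsLetacMora ψ φ ν ∧ IsGenerating ν ∧ nef ν = nef μ ∧
      meanFamily ψ φ ν (meanDomain μ) = nef μ := by
  have hμ := ne_zero_of_atom h0
  obtain ⟨C₁, C₂, hC⟩ := hprim.exists_const
    fun θ hθ => iteratedDeriv_two_cumulant_pos zero_ne_one h0 h1 hθ
  have hgen := isGenerating_tilt (-C₁) C₂ hne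
  -- The tilt shifts the canonical parameter by `C₁` and adds `C₂` to the cumulant, so both
  -- constants of integration become 0.
  refine ⟨tilt (-C₁) C₂ μ, ?_, hgen, nef_tilt _ _ hμ, meanFamily_tilt hC⟩
  have hatom : ∀ x, 0 < μ {x} → 0 < tilt (-C₁) C₂ μ {x} := fun x hx => by
    rw [tilt_singleton]
    exact ENNReal.mul_pos (ENNReal.ofReal_pos.2 (Real.exp_pos _)).ne' hx.ne'
  refine (h.tilt _ _).isLetacMora hgen.nonempty_domain (hatom 0 h0) (hatom 1 h1) fun θ hθ => ?_
  have hθ' := (mem_canonicalDomain_tilt (-C₁) C₂).1 hθ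
  have hk : deriv (cumulant (tilt (-C₁) C₂ μ)) θ = deriv (cumulant μ) (θ + -C₁) := by
    have : cumulant (tilt (-C₁) C₂ μ) =ᶠ[𝓝 θ] fun t => cumulant μ (t + -C₁) + C₂ := by
      filter_upwards [(isOpen_canonicalDomain _).mem_nhds hθ] with t ht
      exact cumulant_tilt _ _ hμ ((mem_canonicalDomain_tilt (-C₁) C₂).1 ht)
    rw [this.deriv_eq, deriv_add_const, deriv_comp_add_const]
  obtain ⟨e1, e2⟩ := hC _ hθ'
  rw [hk, e1, e2, cumulant_tilt _ _ hμ hθ']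
  exact ⟨by ring, rfl⟩

end LetacMora

end NEF

theorem corollary1p3
    (μ : Measure ℝ) (hμ : NEF.IsGenerating μ) (hcount : NEF.IsCounting μ)
    (h0 : 0 < μ {0}) (h1 : 0 < μ {1})
    (ψ φ : ℝ → ℝ) (hprim : NEF.IsPrimitivePair μ ψ φ)
    (hcond1 : Tendsto (deriv φ) (𝓝[>] 0) (𝓝 1))
    (c : ℝ) (hc : 0 < c)
    (hcond2 : Tendsto (fun m => m * Real.exp (-ψ m)) (𝓝[>] 0) (𝓝 c)) :
    ∀ p ∈ NEF.jorgensenSet μ, ∀ μp : Measure ℝ, NEF.IsPower μ p μp →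
      ∀ ψp φp : ℝ → ℝ, (ψp = fun m => ψ (m / p)) → (φp = fun m => p * φ (m / p)) →
        NEF.meanDomain μp = (fun m => p * m) '' NEF.meanDomain μ ∧
        NEF.IsPrimitivePair μp ψp φp ∧
        Tendsto (deriv φp) (𝓝[>] 0) (𝓝 1) ∧
        Tendsto (NEF.letacMoraG ψp) (𝓝[>] 0) (𝓝 (p * c)) ∧
        ∃ ν : Measure ℝ, NEF.IsLetacMora ψp φp ν ∧ NEF.IsGenerating ν ∧
          NEF.nef ν = NEF.nef μp ∧
          NEF.meanFamily ψp φp ν (NEF.meanDomain μp) = NEF.nef μp := by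
  rintro p ⟨hp, -⟩ μp hpow ψp φp rfl rfl
  have hμ0 := NEF.ne_zero_of_atom h0
  have hne := hμ.nonempty_domain
  have hdiv : Tendsto (fun m : ℝ => m / p) (𝓝[>] 0) (𝓝[>] 0) := by
    refine tendsto_nhdsWithin_iff.2 ⟨?_, ?_⟩
    · have : ContinuousAt (fun m : ℝ => m / p) 0 := by fun_prop
      simpa using this.tendsto.mono_left nhdsWithin_le_nhds
    · filter_upwards [self_mem_nhdsWithin] with m hm using div_pos hm hp
  have hprim' := hpow.isPrimitivePair hμ0 hp
    (fun θ hθ => NEF.iteratedDeriv_two_cumulant_pos zero_ne_one h0 h1 hθ) hprim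
  obtain ⟨h0', h1'⟩ := hpow.atoms_pos hp hcount hne h0 h1
  refine ⟨hpow.meanDomain hμ0, hprim', ?_, ?_,
    NEF.exists_isLetacMora (hpow.isCounting hcount hne h0) (hpow.1.symm ▸ hne) h0' h1' hprim'⟩
  · refine (hcond1.comp hdiv).congr fun m => ?_
    have : deriv (fun m => φ (m / p)) m = p⁻¹ * deriv φ (m / p) := by
      simpa [div_eq_inv_mul] using deriv_comp_mul_left p⁻¹ φ m
    rw [deriv_const_mul_field, this]
    simp [hp.ne']
  -- This rests on `G_p(m) = p G(m / p)`.
  · refine ((hcond2.comp hdiv).const_mul p).congr fun m => ?_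
    simp only [Function.comp, NEF.letacMoraG]
    field_simp
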